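/- **Setting.** Let $n_1,n_2\ge 0$ be integers, $N=n_1n_2$, and let $m\ge 1$ be an integer. Let $\tilde B\in[0,1]^{n_1\times n_2}$ be a weighted bi-adjacency matrix with $\sum_{i,j}\tilde B_{i,j}=m$. Write $\operatorname{vec}$ for row-by-row flattening of an $n_1\times n_2$ matrix into a vector of length $N$. *Sampling function.* For $x\in[0,1]^{M}$ with $\sum_i x_i=m'$ a non-negative integer, the random set $\mathsf{UBS}(x,m')\subseteq\{1,\dots,M\}$ is generated recursively as follows. - If $m'=0$, return $\emptyset$. If $m'=1$, draw one index $k$ with probability $x_k$ and return $\{k\}$. If $m'=M$, return $\{1,\dots,M\}$. - Otherwise, partition $\{1,\dots,M\}$ greedily into consecutive groups $G_1,\dots,G_L$: scan $i=1,\dots,M$; add $i$ to the current group (initially empty) if the sum of $x$ over the current group plus $x_i$ is at most $1$, and otherwise close the current group and start a new group $\{i\}$. Let $p_j=\sum_{i\in G_j}x_i$. Draw $J=\mathsf{UBS}\big((1-p_1,\dots,1-p_L),\,L-m'\big)$. Given $J$, independently for each $j\notin J$ draw one index from $G_j$, index $i\in G_j$ having probability $x_i/p_j$. Return the set of drawn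 indices. Let $B\in\{0,1\}^{n_1\times n_2}$ be the random matrix whose vectorization is the indicator vector of $\mathsf{UBS}(\operatorname{vec}(\tilde B),m)$. *Queries.* Let $D_1,D_2$ be tables with $n_1$ and $n_2$ records and with $d_1$ and $d_2$ features, respectively. A $k$-way cross-table query is given by sets of features $S_1\subseteq\{1,\dots,d_1\}$ and $S_2\subseteq\{1,\dots,d_2\}$ with $|S_1|+|S_2|=k$ and $0<|S_1|<k$, and by reference values $y_1,y_2$ of the features of the two tables. Its query vector is $q=\operatorname{vec}(u\,v^{T})\in\{0,1\}^{N}$, where $u_i=1$ iff the $i$-th record of $D_1$ agrees with $y_1$ on all features in $S_1$, and $v_j=1$ iff the $j$-th record of $D_2$ agrees with $y_2$ on all features in $S_2$ (the other entries being $0$). **Theorem.** 1. The entries $(B_{i,j})_{i,j}$ are negatively associated: for all disjoint sets $A_1,A_2$ of index pairs and all real functions $f_1,f_2$ that are both coordinatewise non-decreasing or both coordinatewise non-increasing, $$\operatorname{Cov}\big(f_1(B_e,\,e\in A_1),\ f_2(B_e,\,e\in A_2)\big)\le 0 .$$ 2. For every non-empty finite set $\mathcal Q$ of ($k$-way cross-table)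 query vectors and every $\beta\in(0,1)$, with probability at least $1-\beta$, all $q\in\mathcal Q$ simultaneously satisfy $$\left|\frac1m\,q^{T}\operatorname{vec}(B)-\frac1m\,q^{T}\operatorname{vec}(\tilde B)\right|\le\frac1m\sqrt{\frac N2\,\log\frac{2|\mathcal Q|}{\beta}}\,.$$ -/

import Mathlib

/-! ### The recursive unbiased sampling algorithm -/

/-- A valid input of the sampling function: a vector of probabilities whose entries sum to the
integer `m`. -/
structure IsUBSInput {N : ℕ} (x : Fin N → ℝ) (m : ℕ) : Prop where
  nonneg : ∀ i, 0 ≤ x i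
  le_one : ∀ i, x i ≤ 1
  sum_eq : ∑ i, x i = m

/-- The random draw of one index according to a probability vector `q`. -/
noncomputable def drawIndex {N : ℕ} (q : Fin N → ℝ) (h0 : ∀ i, 0 ≤ q i) (h1 : ∑ i, q i = 1) :
    PMF (Fin N) :=
  PMF.ofFintype (fun i => ENNReal.ofReal (q i)) (by
    rw [← ENNReal.ofReal_sum_of_nonneg (fun i _ => h0 i), h1, ENNReal.ofReal_one])

/-- The sum of the entries of `x` whose index belongs to `G`. -/
def groupSum {N : ℕ} (x : Fin N → ℝ) (G : Finset (Fin N)) : ℝ := ∑ i ∈ G, x i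

/-- One step of the greedy merging. The state is the list of finished groups together with the
current group; the index `i` joins the current group if the sum does not exceed `1`, and otherwise
the current group is finished and `i` opens a new one. -/
noncomputable def mergeStep {N : ℕ} (x : Fin N → ℝ)
    (s : List (Finset (Fin N)) × Finset (Fin N)) (i : Fin N) :
    List (Finset (Fin N)) × Finset (Fin N) :=
  if groupSum x s.2 + x i > 1 then (s.1 ++ [s.2], {i}) else (s.1, insert i s.2)

/-- The state of the greedy merging after all indices have been scanned in increasing order. -/
noncomputable def mergeState {N : ℕ} (x : Fin N → ℝ) :
    List (Finset (Fin N)) × Finset (Fin N) :=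
  (List.finRange N).foldl (mergeStep x) ([], ∅)

/-- The list of groups produced by the greedy merging. -/
noncomputable def mergeGroups {N : ℕ} (x : Fin N → ℝ) : List (Finset (Fin N)) :=
  (mergeState x).1 ++ [(mergeState x).2]

/-- The vector of complement probabilities of the groups. -/
noncomputable def complementProbs {N : ℕ} (x : Fin N → ℝ) : Fin (mergeGroups x).length → ℝ :=
  fun j => 1 - groupSum x ((mergeGroups x).get j)

/-- The invariant of the greedy merging that makes the recursion well defined. -/
structure MergeInv {N : ℕ} (x : Fin N → ℝ)
    (s : List (Finset (Fin N)) × Finset (Fin N)) : Prop where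
  done_le : ∀ G ∈ s.1, groupSum x G ≤ 1
  done_pos : ∀ G ∈ s.1, 0 < groupSum x G
  cur_le : groupSum x s.2 ≤ 1
  cur_nonneg : 0 ≤ groupSum x s.2
  cur_pos : s.1.length ≠ 0 → 0 < groupSum x s.2
  even_len : Even s.1.length → s.1.length ≠ 0 →
    (s.1.length : ℝ) < 2 * (s.1.map (groupSum x)).sum
  odd_len : Odd s.1.length →
    (s.1.length : ℝ) + 1 < 2 * ((s.1.map (groupSum x)).sum + groupSum x s.2)

theorem mergeStep_inv {N m : ℕ} {x : Fin N → ℝ} (hx : IsUBSInput x m)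
    {s : List (Finset (Fin N)) × Finset (Fin N)} (hs : MergeInv x s) {i : Fin N}
    (hi : i ∉ s.2) : MergeInv x (mergeStep x s i) := by
  have h0 := hx.nonneg i
  have h1 := hx.le_one i
  have hc := hs.cur_le
  have hc0 := hs.cur_nonneg
  unfold mergeStep
  split_ifs with h
  · have hsing : groupSum x {i} = x i := by simp [groupSum]
    refine ⟨?_, ?_, ?_, ?_, ?_, ?_, ?_⟩
    · intro G hG
      simp only [List.mem_append, List.mem_singleton] at hG
      rcases hG with hG | rfl
      · exact hs.done_le G hG
      · exact hc
    · intro G hG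
      simp only [List.mem_append, List.mem_singleton] at hG
      rcases hG with hG | rfl
      · exact hs.done_pos G hG
      · linarith
    · simpa [hsing] using h1
    · simpa [hsing] using h0
    · intro _
      simp only [hsing]
      linarith
    · intro he _
      simp only [List.length_append, List.length_singleton] at he
      have ho : Odd s.1.length := by
        rw [Nat.even_add_one] at he
        exact Nat.not_even_iff_odd.mp he
      have := hs.odd_len ho
      simp only [List.length_append, List.length_singleton, List.map_append, List.sum_append,
        List.map_cons, List.map_nil, List.sum_cons, List.sum_nil]
      push_cast
      linarith
    · intro ho
      simp only [List.length_append, List.length_singleton] at ho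
      have he : Even s.1.length := by
        by_contra hne
        exact (Nat.not_even_iff_odd.mpr ho) (by rw [Nat.even_add_one]; exact hne)
      simp only [List.length_append, List.length_singleton, List.map_append, List.sum_append,
        List.map_cons, List.map_nil, List.sum_cons, List.sum_nil, hsing]
      push_cast
      by_cases hz : s.1.length = 0
      · have : s.1 = [] := List.length_eq_zero_iff.mp hz
        simp only [this, List.map_nil, List.sum_nil, List.length_nil, Nat.cast_zero]
        linarith
      · have := hs.even_len he hz
        linarith
  · have hins : groupSum x (insert i s.2) = x i + groupSum x s.2 := by
      simp [groupSum, Finset.sum_insert hi]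
    refine ⟨hs.done_le, hs.done_pos, ?_, ?_, ?_, hs.even_len, ?_⟩
    · simp only [hins]; linarith
    · simp only [hins]; linarith
    · intro hn
      have := hs.cur_pos hn
      simp only [hins]; linarith
    · intro ho
      have := hs.odd_len ho
      simp only [hins]; linarith

theorem mergeStep_foldl {N m : ℕ} {x : Fin N → ℝ} (hx : IsUBSInput x m) (l : List (Fin N))
    (s : List (Finset (Fin N)) × Finset (Fin N)) (hs : MergeInv x s) (hl : l.Nodup)
    (hd : ∀ i ∈ l, i ∉ s.2) :
    MergeInv x (l.foldl (mergeStep x) s) ∧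
      ((l.foldl (mergeStep x) s).1.map (groupSum x)).sum + groupSum x (l.foldl (mergeStep x) s).2
        = (s.1.map (groupSum x)).sum + groupSum x s.2 + (l.map x).sum := by
  induction l generalizing s with
  | nil => exact ⟨hs, by simp⟩
  | cons i l ih =>
    have hi : i ∉ s.2 := hd i (by simp)
    have hil : i ∉ l := (List.nodup_cons.mp hl).1
    have hd' : ∀ j ∈ l, j ∉ (mergeStep x s i).2 := by
      intro j hj
      have hji : j ≠ i := fun h => hil (h ▸ hj)
      have := hd j (by simp [hj])
      unfold mergeStep
      split_ifs <;> simp [hji, this]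
    have := ih (mergeStep x s i) (mergeStep_inv hx hs hi) (List.nodup_cons.mp hl).2 hd'
    refine ⟨this.1, ?_⟩
    rw [List.foldl_cons, this.2]
    have key : ((mergeStep x s i).1.map (groupSum x)).sum + groupSum x (mergeStep x s i).2
        = (s.1.map (groupSum x)).sum + groupSum x s.2 + x i := by
      unfold mergeStep
      split_ifs
      · simp [groupSum]
      · simp [groupSum, Finset.sum_insert hi]; ring
    rw [key, List.map_cons, List.sum_cons]
    ring

theorem IsUBSInput.mergeState_spec {N m : ℕ} {x : Fin N → ℝ} (hx : IsUBSInput x m) :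
    MergeInv x (mergeState x) ∧
      ((mergeState x).1.map (groupSum x)).sum + groupSum x (mergeState x).2 = m := by
  have h := mergeStep_foldl hx (List.finRange N) ([], ∅)
    ⟨by simp, by simp, by simp [groupSum], by simp [groupSum], by simp, by simp, by simp⟩
    (List.nodup_finRange N) (by simp)
  refine ⟨h.1, ?_⟩
  have h2 := h.2
  rw [← List.ofFn_eq_map, List.sum_ofFn, hx.sum_eq] at h2
  simp only [List.map_nil, List.sum_nil, zero_add] at h2
  have h3 : groupSum x ∅ = 0 := by simp [groupSum]
  rw [h3, zero_add] at h2
  exact h2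

theorem IsUBSInput.groupSum_le_one {N m : ℕ} {x : Fin N → ℝ} (hx : IsUBSInput x m)
    (j : Fin (mergeGroups x).length) : groupSum x ((mergeGroups x).get j) ≤ 1 := by
  have hs := hx.mergeState_spec.1
  have hj : (mergeGroups x).get j ∈ mergeGroups x := List.get_mem _ _
  rcases List.mem_append.mp hj with h | h
  · exact hs.done_le _ h
  · rw [List.mem_singleton.mp h]
    exact hs.cur_le

theorem IsUBSInput.groupSum_pos {N m : ℕ} {x : Fin N → ℝ} (hx : IsUBSInput x m) (hm : m ≠ 0)
    (j : Fin (mergeGroups x).length) : 0 < groupSum x ((mergeGroups x).get j) := by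
  obtain ⟨hs, ht⟩ := hx.mergeState_spec
  have hj : (mergeGroups x).get j ∈ mergeGroups x := List.get_mem _ _
  rcases List.mem_append.mp hj with h | h
  · exact hs.done_pos _ h
  · rw [List.mem_singleton.mp h]
    by_cases hz : (mergeState x).1.length = 0
    · rw [List.length_eq_zero_iff.mp hz] at ht
      have : (0 : ℝ) < m := by exact_mod_cast Nat.pos_of_ne_zero hm
      simp at ht
      linarith
    · exact hs.cur_pos hz

theorem IsUBSInput.sum_groupSum {N m : ℕ} {x : Fin N → ℝ} (hx : IsUBSInput x m) :
    ∑ j, groupSum x ((mergeGroups x).get j) = m := by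
  have h : ∑ j, groupSum x ((mergeGroups x).get j) = ((mergeGroups x).map (groupSum x)).sum := by
    rw [← List.sum_ofFn]
    congr 1
    apply List.ext_get <;> simp
  rw [h, ← hx.mergeState_spec.2, mergeGroups]
  simp

theorem IsUBSInput.le_length {N m : ℕ} {x : Fin N → ℝ} (hx : IsUBSInput x m) :
    m ≤ (mergeGroups x).length := by
  have h := Finset.sum_le_sum (fun j (_ : j ∈ Finset.univ) => hx.groupSum_le_one j)
  rw [hx.sum_groupSum] at h
  simp only [Finset.sum_const, Finset.card_univ, Fintype.card_fin, nsmul_eq_mul, mul_one] at h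
  exact_mod_cast h

/-- The second argument of the recursive call decreases, so the algorithm terminates. -/
theorem IsUBSInput.length_sub_lt {N m : ℕ} {x : Fin N → ℝ} (hx : IsUBSInput x m) (hm : m ≠ 0)
    (hm1 : m ≠ 1) : (mergeGroups x).length - m < m := by
  obtain ⟨hs, ht⟩ := hx.mergeState_spec
  have hL : (mergeGroups x).length = (mergeState x).1.length + 1 := by simp [mergeGroups]
  have hc := hs.cur_nonneg
  rcases Nat.even_or_odd (mergeState x).1.length with he | ho
  · by_cases hz : (mergeState x).1.length = 0
    · omega
    · have h := hs.even_len he hz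
      have h2 : ((mergeState x).1.length : ℝ) < 2 * m := by linarith
      have h3 : (mergeState x).1.length < 2 * m := by exact_mod_cast h2
      obtain ⟨r, hr⟩ := he
      omega
  · have h := hs.odd_len ho
    have h2 : ((mergeState x).1.length : ℝ) + 1 < 2 * m := by linarith
    have h3 : (mergeState x).1.length + 1 < 2 * m := by exact_mod_cast h2
    omega

theorem IsUBSInput.complement {N m : ℕ} {x : Fin N → ℝ} (hx : IsUBSInput x m) :
    IsUBSInput (complementProbs x) ((mergeGroups x).length - m) where
  nonneg j := by
    have := hx.groupSum_le_one j
    simp only [complementProbs]; linarith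
  le_one j := by
    have : 0 ≤ groupSum x ((mergeGroups x).get j) := Finset.sum_nonneg fun i _ => hx.nonneg i
    simp only [complementProbs]; linarith
  sum_eq := by
    simp only [complementProbs, Finset.sum_sub_distrib, hx.sum_groupSum]
    rw [Nat.cast_sub hx.le_length]
    simp

/-- The random draw of one index from the group `G`, the index `i ∈ G` having probability
`x i / groupSum x G`. -/
noncomputable def drawFromGroup {N : ℕ} (x : Fin N → ℝ) (G : Finset (Fin N))
    (h0 : ∀ i, 0 ≤ x i) (hG : 0 < groupSum x G) : PMF (Fin N) :=
  drawIndex (fun i => if i ∈ G then x i / groupSum x G else 0)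
    (fun i => by split_ifs <;> [exact div_nonneg (h0 i) hG.le; exact le_rfl])
    (by
      rw [Finset.sum_ite_mem, Finset.univ_inter, ← Finset.sum_div]
      exact div_self hG.ne')

/-- The sampling procedure: run through the groups and, for each group that is not excluded
by `J`, independently draw one index from it and add this index to the output. -/
noncomputable def sampleGroups {N m : ℕ} (x : Fin N → ℝ) (hx : IsUBSInput x m) (hm : m ≠ 0)
    (J : Finset (Fin (mergeGroups x).length)) : PMF (Finset (Fin N)) :=
  (List.finRange (mergeGroups x).length).foldlM
    (fun O i =>
      if i ∈ J then PMF.pure O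
      else (drawFromGroup x ((mergeGroups x).get i) hx.nonneg (hx.groupSum_pos hm i)).map
        fun s => insert s O)
    ∅

/-- The recursive sampling function: the law of the random set of selected indices. -/
noncomputable def UBS {N : ℕ} (x : Fin N → ℝ) (m : ℕ) (hx : IsUBSInput x m) :
    PMF (Finset (Fin N)) :=
  if h0 : m = 0 then PMF.pure ∅
  else if h1 : m = 1 then
    (drawIndex x hx.nonneg (by rw [hx.sum_eq, h1, Nat.cast_one])).map fun k => {k}
  else if m = N then PMF.pure Finset.univ
  else
    (UBS (complementProbs x) ((mergeGroups x).length - m) hx.complement).bind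
      fun J => sampleGroups x hx h0 J
termination_by m
decreasing_by exact hx.length_sub_lt h0 h1

/-- The vectorization (flattening, row by row) of a matrix. -/
def vecM {n₁ n₂ : ℕ} (B : Matrix (Fin n₁) (Fin n₂) ℝ) : Fin (n₁ * n₂) → ℝ :=
  fun k => B (finProdFinEquiv.symm k).1 (finProdFinEquiv.symm k).2

/-- A weighted bi-adjacency matrix with entries in `[0,1]` and total weight `m`. -/
structure IsWeightedBiadjacency {n₁ n₂ : ℕ} (B : Matrix (Fin n₁) (Fin n₂) ℝ) (m : ℕ) : Prop where
  nonneg : ∀ i j, 0 ≤ B i j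
  le_one : ∀ i j, B i j ≤ 1
  sum_eq : ∑ i, ∑ j, B i j = m

theorem IsWeightedBiadjacency.isUBSInput {n₁ n₂ m : ℕ} {B : Matrix (Fin n₁) (Fin n₂) ℝ}
    (hB : IsWeightedBiadjacency B m) : IsUBSInput (vecM B) m where
  nonneg _ := hB.nonneg _ _
  le_one _ := hB.le_one _ _
  sum_eq := by
    have h := finProdFinEquiv.symm.sum_comp (fun e : Fin n₁ × Fin n₂ => B e.1 e.2)
    rw [← hB.sum_eq, ← Fintype.sum_prod_type' (f := fun i j => B i j), ← h]
    rfl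

/-- The unweighted bi-adjacency matrix whose edges are the indices in `O`. -/
def indexMatrix {n₁ n₂ : ℕ} (O : Finset (Fin (n₁ * n₂))) : Matrix (Fin n₁) (Fin n₂) ℝ :=
  Matrix.of fun i j => if finProdFinEquiv (i, j) ∈ O then 1 else 0

/-- The Borel (product) measurable structure on real matrices. -/
instance matrixMeasurableSpace {n₁ n₂ : ℕ} : MeasurableSpace (Matrix (Fin n₁) (Fin n₂) ℝ) :=
  inferInstanceAs (MeasurableSpace (Fin n₁ → Fin n₂ → ℝ))

/-- The unbiased sampling algorithm: the law of the random unweighted bi-adjacency matrix that it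
outputs on the weighted bi-adjacency matrix `B` with total weight `m`. -/
noncomputable def unbiasedSampling {n₁ n₂ : ℕ} (B : Matrix (Fin n₁) (Fin n₂) ℝ) (m : ℕ)
    (hB : IsWeightedBiadjacency B m) : PMF (Matrix (Fin n₁) (Fin n₂) ℝ) :=
  (UBS (vecM B) m hB.isUBSInput).map indexMatrix

/-! ### Cross-table marginal queries -/

/-- A `k`-way cross-table marginal query on two tables with feature domains `X₁ j` and `X₂ j`:
nonempty sets of features `S₁`, `S₂` with `k` features in total, and reference values. -/
structure CrossQuery {d₁ d₂ : ℕ} (X₁ : Fin d₁ → Type*) (X₂ : Fin d₂ → Type*) (k : ℕ) where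
  S₁ : Finset (Fin d₁)
  S₂ : Finset (Fin d₂)
  card_add : S₁.card + S₂.card = k
  card_pos : 0 < S₁.card
  card_lt : S₁.card < k
  y₁ : ∀ j, X₁ j
  y₂ : ∀ j, X₂ j

/-- The 0/1 vector of those records of the table `D` that agree with `y` on the features in `S`. -/
noncomputable def matchVector {n d : ℕ} {X : Fin d → Type*} (D : Fin n → ∀ j, X j)
    (S : Finset (Fin d)) (y : ∀ j, X j) : Fin n → ℝ :=
  Set.indicator {i | ∀ j ∈ S, D i j = y j} 1

/-- The query vector of a cross-table query on the tables `D₁`, `D₂`. -/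
noncomputable def CrossQuery.vector {n₁ n₂ d₁ d₂ k : ℕ} {X₁ : Fin d₁ → Type*}
    {X₂ : Fin d₂ → Type*} (D₁ : Fin n₁ → ∀ j, X₁ j) (D₂ : Fin n₂ → ∀ j, X₂ j)
    (q : CrossQuery X₁ X₂ k) : Fin (n₁ * n₂) → ℝ :=
  vecM (Matrix.vecMulVec (matchVector D₁ q.S₁ q.y₁) (matchVector D₂ q.S₂ q.y₂))

/-! ### Negative association -/

/-- Negative association: functions of disjoint subfamilies that are both coordinatewise
non-decreasing, or both coordinatewise non-increasing, have non-positive covariance whenever the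
covariance is defined. -/
def NegativelyAssociated {Ω ι : Type*} [MeasurableSpace Ω] (X : ι → Ω → ℝ)
    (μ : MeasureTheory.Measure Ω) : Prop :=
  ∀ (A₁ A₂ : Finset ι), Disjoint A₁ A₂ →
    ∀ (f₁ : (A₁ → ℝ) → ℝ) (f₂ : (A₂ → ℝ) → ℝ),
      (Monotone f₁ ∧ Monotone f₂) ∨ (Antitone f₁ ∧ Antitone f₂) →
      MeasureTheory.Integrable (fun ω => f₁ fun i => X i ω) μ →
      MeasureTheory.Integrable (fun ω => f₂ fun i => X i ω) μ →
      MeasureTheory.Integrable (fun ω => (f₁ fun i => X i ω) * (f₂ fun i => X i ω)) μ →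
      ProbabilityTheory.covariance (fun ω => f₁ fun i => X i ω) (fun ω => f₂ fun i => X i ω) μ ≤ 0

/-! ### Expectations over finite probability spaces -/

/-! Negative association is carried through the recursion. In the recursive case the output is the
image `T.image K`, where `T`, the set of retained groups, is the complement of the recursive sample,
and `K` picks one index from every group, independently of `T` and of each other
(`expect_bind_sampleGroups`). Complementation preserves negative association because increasing
functions become decreasing ones (`PMF.NegAssoc.map_compl`). Taking the image preserves it as well
(`PMF.NegAssoc.expect_image_mul_le`): for fixed `K` the parts of the image inside and outside `A`
come from disjoint parts of `T`; the two conditional means, as functions of `K`, are then compared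
by `productExpect_mul_le`, where a choice in `A` can only help the first and a choice off `A` only
the second. Induction on `m` gives `UBS_negAssoc`.

The same description gives unbiasedness (`UBS_expect_mem`): group `j` is retained with probability
`p_j`, and then yields `i` with probability `x_i / p_j`.

For the queries, negative association bounds the joint exponential moment by the product of the
marginal ones, so Hoeffding's argument works as for independent entries with `N` summands. A union
bound over the queries concludes; query vectors enter only through their entries lying in `[0,1]`.
-/

/-- The expectation of a real function under a probability mass function on a finite type. -/
noncomputable def PMF.expect {α : Type*} [Fintype α] (p : PMF α) (f : α → ℝ) : ℝ :=
  ∑ a, (p a).toReal * f a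

theorem PMF.sum_toReal {α : Type*} [Fintype α] (p : PMF α) : ∑ a, (p a).toReal = 1 := by
  rw [← ENNReal.toReal_sum fun a _ => p.apply_ne_top a, ← tsum_fintype (L := .unconditional _),
    p.tsum_coe, ENNReal.toReal_one]

theorem PMF.expect_const {α : Type*} [Fintype α] (p : PMF α) (c : ℝ) :
    p.expect (fun _ => c) = c := by
  rw [PMF.expect, ← Finset.sum_mul, p.sum_toReal, one_mul]

theorem PMF.expect_mono {α : Type*} [Fintype α] (p : PMF α) {f g : α → ℝ} (h : ∀ a, f a ≤ g a) :
    p.expect f ≤ p.expect g :=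
  Finset.sum_le_sum fun a _ => mul_le_mul_of_nonneg_left (h a) ENNReal.toReal_nonneg

theorem PMF.expect_neg {α : Type*} [Fintype α] (p : PMF α) (f : α → ℝ) :
    p.expect (fun a => -f a) = -p.expect f := by
  simp [PMF.expect]

theorem PMF.expect_bind {α β : Type*} [Fintype α] [Fintype β] (p : PMF α) (k : α → PMF β)
    (f : β → ℝ) : (p.bind k).expect f = p.expect fun a => (k a).expect f := by
  have h : ∀ b, ((p.bind k) b).toReal = ∑ a, (p a).toReal * (k a b).toReal := fun b => by
    rw [PMF.bind_apply, tsum_fintype, ENNReal.toReal_sum fun a _ =>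
      ENNReal.mul_ne_top (p.apply_ne_top a) ((k a).apply_ne_top b)]
    simp
  simp only [PMF.expect, h, Finset.sum_mul, Finset.mul_sum]
  rw [Finset.sum_comm]
  simp only [mul_assoc]

theorem PMF.expect_pure {α : Type*} [Fintype α] (a : α) (f : α → ℝ) :
    (PMF.pure a).expect f = f a := by
  classical
  rw [PMF.expect, Finset.sum_eq_single a]
  · simp
  · intro b _ hb
    simp [PMF.pure_apply, hb]
  · simp

theorem PMF.expect_map {α β : Type*} [Fintype α] [Fintype β] (p : PMF α) (k : α → β)
    (f : β → ℝ) : (p.map k).expect f = p.expect fun a => f (k a) := by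
  rw [← PMF.bind_pure_comp, PMF.expect_bind]
  simp only [Function.comp, PMF.expect_pure]

theorem PMF.integral_toMeasure {α : Type*} [Fintype α] [MeasurableSpace α]
    [MeasurableSingletonClass α] (p : PMF α) (f : α → ℝ) :
    ∫ a, f a ∂p.toMeasure = p.expect f := by
  simp [PMF.integral_eq_sum, PMF.expect]

/-! ### Independent choices -/

/-- The expectation of a function of independent choices, the `j`-th one having weights `w j`. -/
def productExpect {n : ℕ} {α : Type*} [Fintype α] (w : Fin n → α → ℝ) (F : (Fin n → α) → ℝ) : ℝ :=
  ∑ K : Fin n → α, (∏ j, w j (K j)) * F K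

theorem productExpect_zero {α : Type*} [Fintype α] (w : Fin 0 → α → ℝ) (F : (Fin 0 → α) → ℝ) :
    productExpect w F = F Fin.elim0 := by
  simp [productExpect, Subsingleton.elim (default : Fin 0 → α) Fin.elim0]

theorem productExpect_succ {n : ℕ} {α : Type*} [Fintype α] (w : Fin (n + 1) → α → ℝ)
    (F : (Fin (n + 1) → α) → ℝ) :
    productExpect w F =
      ∑ s, w 0 s * productExpect (fun j => w j.succ) fun K => F (Fin.cons s K) := by
  rw [productExpect, ← (Fin.consEquiv fun _ => α).sum_comp, Fintype.sum_prod_type]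
  simp only [productExpect, Finset.mul_sum, Fin.consEquiv_apply, Fin.prod_univ_succ,
    Fin.cons_zero, Fin.cons_succ, mul_assoc]
  rfl

theorem productExpect_mono {n : ℕ} {α : Type*} [Fintype α] {w : Fin n → α → ℝ}
    (hw : ∀ j s, 0 ≤ w j s) {F G : (Fin n → α) → ℝ} (h : ∀ K, F K ≤ G K) :
    productExpect w F ≤ productExpect w G :=
  Finset.sum_le_sum fun K _ =>
    mul_le_mul_of_nonneg_left (h K) (Finset.prod_nonneg fun j _ => hw j _)

theorem PMF.expect_productExpect_comm {n : ℕ} {α β : Type*} [Fintype α] [Fintype β] (p : PMF β)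
    (w : Fin n → α → ℝ) (F : β → (Fin n → α) → ℝ) :
    p.expect (fun b => productExpect w (F b)) =
      productExpect w fun K => p.expect fun b => F b K := by
  simp only [PMF.expect, productExpect, Finset.mul_sum]
  rw [Finset.sum_comm]
  simp only [mul_left_comm]

theorem productExpect_single {n : ℕ} {α : Type*} [Fintype α] [DecidableEq α] (w : Fin n → α → ℝ)
    (hw : ∀ j, ∑ s, w j s = 1) (j₀ : Fin n) (i : α) :
    productExpect w (fun K => if K j₀ = i then 1 else 0) = w j₀ i := by
  -- Absorbing the indicator into the `j₀`-th factor makes the sum over `K` factor; every other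
  -- factor sums to `1`.
  have h : ∀ K : Fin n → α, (∏ j, w j (K j)) * (if K j₀ = i then (1 : ℝ) else 0) =
      ∏ j, (w j (K j) * if j = j₀ then (if K j = i then 1 else 0) else 1) := fun K => by
    rw [Finset.prod_mul_distrib, Finset.prod_ite_eq' Finset.univ j₀]
    simp
  simp only [productExpect, h]
  rw [← Fintype.piFinset_univ,
    ← Finset.prod_univ_sum (fun _ => Finset.univ)
      (fun j s => w j s * if j = j₀ then (if s = i then (1 : ℝ) else 0) else 1),
    Finset.prod_eq_single j₀]
  · simp
  · intro j _ hj
    simp [hj, hw]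
  · simp

/-- A random choice is negatively associated: if `φ` is least off `A` and `γ` is least on `A`, then
they are non-positively correlated. -/
theorem sum_mul_le_of_least {α : Type*} [Fintype α] {w : α → ℝ} (hw : ∀ s, 0 ≤ w s)
    (hw1 : ∑ s, w s = 1) (A : Set α) {φ γ : α → ℝ} (hφ : ∀ s s', s ∉ A → φ s ≤ φ s')
    (hγ : ∀ s s', s ∈ A → γ s ≤ γ s') :
    ∑ s, w s * (φ s * γ s) ≤ (∑ s, w s * φ s) * ∑ s, w s * γ s := by
  have : Nonempty α := by
    by_contra h
    rw [not_nonempty_iff] at h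
    simp at hw1
  obtain ⟨a, ha⟩ := Finite.exists_min φ
  obtain ⟨b, hb⟩ := Finite.exists_min γ
  -- At every `s` one of `φ`, `γ` attains its minimum, so `(φ s - φ a) * (γ s - γ b) = 0`. Hence the
  -- gap in the inequality is exactly `(E φ - φ a) * (E γ - γ b) ≥ 0`.
  have h1 : ∑ s, w s * (φ s * γ s) =
      φ a * ∑ s, w s * γ s + γ b * ∑ s, w s * φ s - φ a * γ b := by
    have h2 : φ a * γ b = ∑ s, w s * (φ a * γ b) := by rw [← Finset.sum_mul, hw1, one_mul]
    rw [h2, Finset.mul_sum, Finset.mul_sum, ← Finset.sum_add_distrib, ← Finset.sum_sub_distrib]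
    refine Finset.sum_congr rfl fun s _ => ?_
    by_cases hs : s ∈ A
    · rw [le_antisymm (hγ s b hs) (hb s)]; ring
    · rw [le_antisymm (hφ s a hs) (ha s)]; ring
  have h3 : ∀ (ψ : α → ℝ) (c : ℝ), (∀ s, c ≤ ψ s) → c ≤ ∑ s, w s * ψ s := fun ψ c h => by
    calc c = ∑ s, w s * c := by rw [← Finset.sum_mul, hw1, one_mul]
      _ ≤ _ := Finset.sum_le_sum fun s _ => mul_le_mul_of_nonneg_left (h s) (hw s)
  rw [h1]
  nlinarith [mul_nonneg (sub_nonneg.mpr (h3 φ _ ha)) (sub_nonneg.mpr (h3 γ _ hb))]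

/-- Independent random choices are negatively associated. -/
theorem productExpect_mul_le {n : ℕ} {α : Type*} [Fintype α] {w : Fin n → α → ℝ}
    (hw : ∀ j s, 0 ≤ w j s) (hw1 : ∀ j, ∑ s, w j s = 1) (A : Set α) {φ γ : (Fin n → α) → ℝ}
    (hφ : ∀ K j s s', s ∉ A → φ (Function.update K j s) ≤ φ (Function.update K j s'))
    (hγ : ∀ K j s s', s ∈ A → γ (Function.update K j s) ≤ γ (Function.update K j s')) :
    productExpect w (fun K => φ K * γ K) ≤ productExpect w φ * productExpect w γ := by
  induction n with
  | zero => simp [productExpect_zero]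
  | succ n ih =>
    simp only [productExpect_succ w]
    -- Condition on choice `0`: induction treats the remaining choices, and the conditional means,
    -- as functions of choice `0`, inherit the leastness conditions.
    refine le_trans (Finset.sum_le_sum fun s _ => mul_le_mul_of_nonneg_left
      (ih (w := fun j => w j.succ) (fun j => hw j.succ) (fun j => hw1 j.succ)
        (φ := fun K => φ (Fin.cons s K)) (γ := fun K => γ (Fin.cons s K)) ?_ ?_) (hw 0 s)) ?_
    · intro K j a b h
      simpa only [Fin.cons_update] using hφ (Fin.cons s K) j.succ a b h
    · intro K j a b h
      simpa only [Fin.cons_update] using hγ (Fin.cons s K) j.succ a b h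
    · refine sum_mul_le_of_least (hw 0) (hw1 0) A ?_ ?_
      · intro a b h
        refine productExpect_mono (fun j => hw j.succ) fun K => ?_
        simpa only [Fin.update_cons_zero] using hφ (Fin.cons a K) 0 a b h
      · intro a b h
        refine productExpect_mono (fun j => hw j.succ) fun K => ?_
        simpa only [Fin.update_cons_zero] using hγ (Fin.cons a K) 0 a b h

/-- Running through the groups and drawing an index from each group that is not excluded amounts to
drawing an index from every group and keeping those of the groups that are not excluded. -/
theorem expect_foldlM_draw {n : ℕ} {α : Type} [Fintype α] [DecidableEq α] (d : Fin n → PMF α)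
    (J : Fin n → Prop) [DecidablePred J] (O : Finset α) (f : Finset α → ℝ) :
    PMF.expect ((List.finRange n).foldlM
      (fun O i => if J i then PMF.pure O else (d i).map fun s => insert s O) O) f =
      productExpect (fun j s => (d j s).toReal)
        fun K => f (O ∪ (Finset.univ.filter fun j => ¬ J j).image K) := by
  induction n generalizing O with
  | zero =>
    rw [productExpect_zero]
    simp only [List.finRange_zero, List.foldlM_nil, Finset.univ_eq_empty, Finset.filter_empty,
      Finset.image_empty, Finset.union_empty]
    exact PMF.expect_pure O f
  | succ n ih =>
    rw [List.finRange_succ, List.foldlM_cons, productExpect_succ]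
    simp only [List.foldlM_map]
    have himg : ∀ (s : α) (K : Fin n → α),
        (Finset.univ.filter fun j => ¬ J j).image (Fin.cons s K : Fin (n + 1) → α) =
          (if J 0 then ∅ else {s}) ∪
            (Finset.univ.filter fun j : Fin n => ¬ J j.succ).image K := by
      intro s K
      ext a
      simp only [Finset.mem_image, Finset.mem_filter, Finset.mem_univ, true_and, Fin.exists_fin_succ,
        Fin.cons_zero, Fin.cons_succ, Finset.mem_union]
      split_ifs with h <;> simp [h, eq_comm]
    simp only [himg]
    have hb : ∀ (p : PMF (Finset α)) (k : Finset α → PMF (Finset α)),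
        PMF.expect (p >>= k) f = p.expect fun a => (k a).expect f := fun p k => p.expect_bind k f
    rw [hb]
    simp only [ih (fun j => d j.succ) (fun j => J j.succ)]
    split_ifs with h
    · rw [PMF.expect_pure]
      simp only [Finset.empty_union]
      -- The draw from an excluded group is a dummy variable, which integrates out to `1`.
      rw [← Finset.sum_mul, PMF.sum_toReal, one_mul]
    · rw [PMF.expect_map]
      simp only [PMF.expect, ← Finset.union_assoc]
      refine Finset.sum_congr rfl fun s _ => ?_
      rw [Finset.insert_eq, Finset.union_comm {s} O]

/-! ### Negative association of random sets -/

/-- A random finite set is negatively associated: increasing functions of the parts of the set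
inside and outside any given set are non-positively correlated. -/
def PMF.NegAssoc {α : Type*} [Fintype α] [DecidableEq α] (p : PMF (Finset α)) : Prop :=
  ∀ (A : Finset α) (f g : Finset α → ℝ), Monotone f → Monotone g →
    p.expect (fun O => f (O ∩ A) * g (O \ A)) ≤
      p.expect (fun O => f (O ∩ A)) * p.expect fun O => g (O \ A)

theorem PMF.negAssoc_pure {α : Type*} [Fintype α] [DecidableEq α] (O : Finset α) :
    (PMF.pure O).NegAssoc := fun A f g _ _ => by
  simp only [PMF.expect_pure, le_refl]

/-- The part inside `A` is empty, hence least, when the drawn index is off `A`; the part outside is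
empty when it is in `A`. -/
theorem PMF.negAssoc_map_singleton {α : Type*} [Fintype α] [DecidableEq α] (p : PMF α) :
    (p.map fun k => ({k} : Finset α)).NegAssoc := fun A f g hf hg => by
  simp only [PMF.expect_map]
  refine sum_mul_le_of_least (fun _ => ENNReal.toReal_nonneg) p.sum_toReal (A : Set α) ?_ ?_
  · intro s s' hs
    rw [Finset.singleton_inter_of_notMem (by simpa using hs)]
    exact hf (Finset.empty_subset _)
  · intro s s' hs
    rw [Finset.sdiff_eq_empty_iff_subset.mpr (by simpa using hs)]
    exact hg (Finset.empty_subset _)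

theorem PMF.NegAssoc.antitone {α : Type*} [Fintype α] [DecidableEq α] {p : PMF (Finset α)}
    (hp : p.NegAssoc) (A : Finset α) {f g : Finset α → ℝ} (hf : Antitone f) (hg : Antitone g) :
    p.expect (fun O => f (O ∩ A) * g (O \ A)) ≤
      p.expect (fun O => f (O ∩ A)) * p.expect fun O => g (O \ A) := by
  have h := hp A (fun O => -f O) (fun O => -g O) hf.neg hg.neg
  simpa only [neg_mul_neg, PMF.expect_neg] using h

/-- Each part of the complement is determined by the same part of the set, in an order-reversing
way, so the antitone form applies. -/
theorem PMF.NegAssoc.map_compl {α : Type*} [Fintype α] [DecidableEq α] {p : PMF (Finset α)}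
    (hp : p.NegAssoc) : (p.map compl).NegAssoc := fun A f g hf hg => by
  simp only [PMF.expect_map]
  have h := hp.antitone A (f := fun S => f (A \ S)) (g := fun S => g (Aᶜ \ S))
    (fun S T h => hf (Finset.sdiff_subset_sdiff le_rfl h))
    (fun S T h => hg (Finset.sdiff_subset_sdiff le_rfl h))
  have h1 : ∀ O : Finset α, A \ (O ∩ A) = Oᶜ ∩ A := fun O => by ext; simp; tauto
  have h2 : ∀ O : Finset α, Aᶜ \ (O \ A) = Oᶜ \ A := fun O => by ext; simp; tauto
  simpa only [h1, h2] using h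

/-- Drawing independently one index for each element of a negatively associated random set gives a
negatively associated random set. -/
theorem PMF.NegAssoc.expect_image_mul_le {n : ℕ} {α : Type*} [Fintype α] [DecidableEq α]
    {p : PMF (Finset (Fin n))} (hp : p.NegAssoc) {w : Fin n → α → ℝ} (hw : ∀ j s, 0 ≤ w j s)
    (hw1 : ∀ j, ∑ s, w j s = 1) (A : Finset α) {f g : Finset α → ℝ} (hf : Monotone f)
    (hg : Monotone g) :
    p.expect (fun T => productExpect w fun K => f (T.image K ∩ A) * g (T.image K \ A)) ≤
      p.expect (fun T => productExpect w fun K => f (T.image K ∩ A)) *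
        p.expect fun T => productExpect w fun K => g (T.image K \ A) := by
  -- Average over `T` first, with the choices `K` held fixed.
  simp only [PMF.expect_productExpect_comm]
  refine le_trans (productExpect_mono hw (G := fun K =>
    p.expect (fun T => f (T.image K ∩ A)) * p.expect fun T => g (T.image K \ A)) ?_) ?_
  · intro K
    have h1 : ∀ T : Finset (Fin n),
        T.image K ∩ A = (T ∩ Finset.univ.filter fun j => K j ∈ A).image K := by
      intro T; ext a; simp only [Finset.mem_inter, Finset.mem_image, Finset.mem_filter,
        Finset.mem_univ, true_and]
      grind
    have h2 : ∀ T : Finset (Fin n),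
        T.image K \ A = (T \ Finset.univ.filter fun j => K j ∈ A).image K := by
      intro T; ext a; simp only [Finset.mem_sdiff, Finset.mem_image, Finset.mem_filter,
        Finset.mem_univ, true_and]
      grind
    simp only [h1, h2]
    exact hp _ (fun T => f (T.image K)) (fun T => g (T.image K))
      (fun S T h => hf (Finset.image_subset_image h))
      (fun S T h => hg (Finset.image_subset_image h))
  -- Moving choice `j` off `A` removes its contribution to the part inside `A`, so the first mean
  -- becomes least; symmetrically for the second.
  · refine productExpect_mul_le hw hw1 (A : Set α) ?_ ?_
    · intro K j s s' hs
      refine p.expect_mono fun T => hf fun a ha => ?_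
      simp only [Finset.mem_inter, Finset.mem_image] at ha ⊢
      obtain ⟨⟨t, ht, rfl⟩, hA⟩ := ha
      have htj : t ≠ j := by
        rintro rfl
        rw [Function.update_self] at hA
        exact hs hA
      exact ⟨⟨t, ht, by simp [htj]⟩, hA⟩
    · intro K j s s' hs
      refine p.expect_mono fun T => hg fun a ha => ?_
      simp only [Finset.mem_sdiff, Finset.mem_image] at ha ⊢
      obtain ⟨⟨t, ht, rfl⟩, hA⟩ := ha
      have htj : t ≠ j := by
        rintro rfl
        rw [Function.update_self] at hA
        exact hA hs
      exact ⟨⟨t, ht, by simp [htj]⟩, hA⟩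

/-! ### The groups form a partition -/

/-- Invariant of the scan: each scanned index is fresh, so adding it to the current group or opening
a singleton keeps the groups disjoint. -/
theorem mergeStep_foldl_partition {N : ℕ} (x : Fin N → ℝ) (l : List (Fin N))
    (s : List (Finset (Fin N)) × Finset (Fin N)) (hl : l.Nodup)
    (hd : ∀ i ∈ l, ∀ G ∈ s.1 ++ [s.2], i ∉ G) (hs : (s.1 ++ [s.2]).Pairwise Disjoint) :
    let t := l.foldl (mergeStep x) s
    (t.1 ++ [t.2]).Pairwise Disjoint ∧
      ∀ i, (∃ G ∈ t.1 ++ [t.2], i ∈ G) ↔ (∃ G ∈ s.1 ++ [s.2], i ∈ G) ∨ i ∈ l := by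
  induction l generalizing s with
  | nil => simpa using hs
  | cons i l ih =>
    obtain ⟨hil, hl'⟩ := List.nodup_cons.mp hl
    have hmem : ∀ a, (∃ G ∈ (mergeStep x s i).1 ++ [(mergeStep x s i).2], a ∈ G) ↔
        (∃ G ∈ s.1 ++ [s.2], a ∈ G) ∨ a = i := by
      intro a
      unfold mergeStep
      split_ifs
      · simp [or_and_right, exists_or, or_assoc]
      · simp only [List.mem_append, List.mem_singleton, or_and_right, exists_or, exists_eq_left,
          Finset.mem_insert, or_assoc]
        rw [or_comm (a := a = i)]
    have hpair : ((mergeStep x s i).1 ++ [(mergeStep x s i).2]).Pairwise Disjoint := by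
      have hi := hd i (by simp)
      unfold mergeStep
      split_ifs
      · refine List.pairwise_append.mpr ⟨hs, by simp, fun G hG H hH => ?_⟩
        rw [List.mem_singleton.mp hH, Finset.disjoint_singleton_right]
        exact hi G hG
      · obtain ⟨h1, -, h2⟩ := List.pairwise_append.mp hs
        refine List.pairwise_append.mpr ⟨h1, by simp, fun G hG H hH => ?_⟩
        rw [List.mem_singleton.mp hH, Finset.disjoint_insert_right]
        exact ⟨hi G (by simp [hG]), h2 G hG _ (by simp)⟩
    have hd' : ∀ j ∈ l, ∀ G ∈ (mergeStep x s i).1 ++ [(mergeStep x s i).2], j ∉ G := by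
      intro j hj G hG hjG
      rcases (hmem j).mp ⟨G, hG, hjG⟩ with ⟨H, hH, hjH⟩ | rfl
      · exact hd j (by simp [hj]) H hH hjH
      · exact hil hj
    obtain ⟨h1, h2⟩ := ih (mergeStep x s i) hl' hd' hpair
    refine ⟨h1, fun a => ?_⟩
    rw [List.foldl_cons, h2 a, hmem a, List.mem_cons, or_assoc]

theorem exists_unique_mergeGroup {N : ℕ} (x : Fin N → ℝ) (i : Fin N) :
    ∃ j₀, ∀ j, i ∈ (mergeGroups x).get j ↔ j = j₀ := by
  obtain ⟨h1, h2⟩ := mergeStep_foldl_partition x (List.finRange N) ([], ∅)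
    (List.nodup_finRange N) (by simp) (by simp)
  obtain ⟨G, hG, hi⟩ := (h2 i).mpr (Or.inr (List.mem_finRange i))
  obtain ⟨j₀, rfl⟩ := List.mem_iff_get.mp hG
  refine ⟨j₀, fun j => ⟨fun hj => ?_, fun hj => hj ▸ hi⟩⟩
  by_contra hne
  rcases lt_or_gt_of_ne hne with h | h
  · exact Finset.disjoint_left.mp (List.pairwise_iff_get.mp h1 _ _ h) hj hi
  · exact Finset.disjoint_left.mp (List.pairwise_iff_get.mp h1 _ _ h) hi hj

/-! ### The law of the sampling function -/

theorem drawIndex_toReal {N : ℕ} (q : Fin N → ℝ) (h0 : ∀ i, 0 ≤ q i) (h1 : ∑ i, q i = 1)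
    (i : Fin N) : (drawIndex q h0 h1 i).toReal = q i := by
  simp [drawIndex, ENNReal.toReal_ofReal (h0 i)]

/-- The probabilities of the indices in a draw from the `j`-th group. -/
noncomputable def groupWeight {N : ℕ} (x : Fin N → ℝ) (j : Fin (mergeGroups x).length)
    (i : Fin N) : ℝ :=
  if i ∈ (mergeGroups x).get j then x i / groupSum x ((mergeGroups x).get j) else 0

theorem IsUBSInput.groupWeight_nonneg {N m : ℕ} {x : Fin N → ℝ} (hx : IsUBSInput x m)
    (j : Fin (mergeGroups x).length) (i : Fin N) : 0 ≤ groupWeight x j i := by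
  unfold groupWeight
  split_ifs
  · exact div_nonneg (hx.nonneg i) (Finset.sum_nonneg fun i _ => hx.nonneg i)
  · exact le_rfl

theorem IsUBSInput.sum_groupWeight {N m : ℕ} {x : Fin N → ℝ} (hx : IsUBSInput x m) (hm : m ≠ 0)
    (j : Fin (mergeGroups x).length) : ∑ i, groupWeight x j i = 1 := by
  simp only [groupWeight]
  rw [Finset.sum_ite_mem, Finset.univ_inter, ← Finset.sum_div]
  exact div_self (hx.groupSum_pos hm j).ne'

theorem expect_sampleGroups {N m : ℕ} {x : Fin N → ℝ} (hx : IsUBSInput x m) (hm : m ≠ 0)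
    (J : Finset (Fin (mergeGroups x).length)) (f : Finset (Fin N) → ℝ) :
    (sampleGroups x hx hm J).expect f =
      productExpect (groupWeight x) fun K => f (Jᶜ.image K) := by
  have h := expect_foldlM_draw
    (fun j => drawFromGroup x ((mergeGroups x).get j) hx.nonneg (hx.groupSum_pos hm j))
    (fun j => j ∈ J) ∅ f
  have hJ : (Finset.univ.filter fun j => j ∉ J) = Jᶜ := by ext; simp
  simp only [drawFromGroup, drawIndex_toReal, Finset.empty_union, hJ] at h
  exact h

theorem expect_bind_sampleGroups {N m : ℕ} {x : Fin N → ℝ} (hx : IsUBSInput x m) (hm : m ≠ 0)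
    (p : PMF (Finset (Fin (mergeGroups x).length))) (f : Finset (Fin N) → ℝ) :
    (p.bind fun J => sampleGroups x hx hm J).expect f =
      (p.map compl).expect fun T => productExpect (groupWeight x) fun K => f (T.image K) := by
  simp only [PMF.expect_bind, PMF.expect_map, expect_sampleGroups]

theorem UBS_negAssoc {N m : ℕ} {x : Fin N → ℝ} (hx : IsUBSInput x m) :
    (UBS x m hx).NegAssoc := by
  induction m using Nat.strong_induction_on generalizing N with
  | _ m ih =>
    rw [UBS]
    split_ifs with h0 h1 h2
    · exact PMF.negAssoc_pure _
    · exact PMF.negAssoc_map_singleton _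
    · exact PMF.negAssoc_pure _
    · intro A f g hf hg
      simp only [expect_bind_sampleGroups]
      exact (ih _ (hx.length_sub_lt h0 h1) hx.complement).map_compl.expect_image_mul_le
        hx.groupWeight_nonneg (hx.sum_groupWeight h0) A hf hg

theorem PMF.expect_not_mem {α : Type*} [Fintype α] [DecidableEq α] (p : PMF (Finset α)) (i : α) :
    p.expect (fun O => if i ∉ O then 1 else 0) = 1 - p.expect fun O => if i ∈ O then 1 else 0 := by
  rw [eq_sub_iff_add_eq]
  refine Eq.trans ?_ p.sum_toReal
  simp only [PMF.expect, ← Finset.sum_add_distrib]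
  refine Finset.sum_congr rfl fun O _ => ?_
  by_cases h : i ∈ O <;> simp [h]

/-- The sampling function is unbiased. -/
theorem UBS_expect_mem {N m : ℕ} {x : Fin N → ℝ} (hx : IsUBSInput x m) (i : Fin N) :
    (UBS x m hx).expect (fun O => if i ∈ O then 1 else 0) = x i := by
  induction m using Nat.strong_induction_on generalizing N with
  | _ m ih =>
    rw [UBS]
    split_ifs with h0 h1 h2
    · have h := (Finset.sum_eq_zero_iff_of_nonneg fun i _ => hx.nonneg i).mp
        (by rw [hx.sum_eq, h0, Nat.cast_zero]) i (Finset.mem_univ i)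
      simp [PMF.expect_pure, h]
    · rw [PMF.expect_map]
      simp [PMF.expect, drawIndex_toReal]
    · have h := (Finset.sum_eq_sum_iff_of_le (f := x) (g := fun _ => 1)
        fun i _ => hx.le_one i).mp (by rw [hx.sum_eq, h2]; simp) i (Finset.mem_univ i)
      simp [PMF.expect_pure, h]
    · obtain ⟨j₀, hj₀⟩ := exists_unique_mergeGroup x i
      have hw : ∀ j, groupWeight x j i ≠ 0 → j = j₀ := fun j h => by
        rw [← hj₀]
        by_contra hj
        exact h (if_neg hj)
      have hK : ∀ T : Finset (Fin (mergeGroups x).length),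
          productExpect (groupWeight x) (fun K => if i ∈ T.image K then 1 else 0) =
            (if j₀ ∈ T then 1 else 0) * groupWeight x j₀ i := fun T => by
        rw [← productExpect_single _ (hx.sum_groupWeight h0), productExpect, productExpect,
          Finset.mul_sum]
        refine Finset.sum_congr rfl fun K _ => ?_
        -- A choice `K` may send a wrong group to `i`, but only with weight `0`; elsewhere only
        -- group `j₀` can produce `i`.
        by_cases hz : ∏ j, groupWeight x j (K j) = 0
        · simp [hz]
        · have hne := fun j => Finset.prod_ne_zero_iff.mp hz j (Finset.mem_univ j)
          have hiff : i ∈ T.image K ↔ j₀ ∈ T ∧ K j₀ = i := by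
            simp only [Finset.mem_image]
            constructor
            · rintro ⟨j, hj, rfl⟩
              obtain rfl := hw j (hne j)
              exact ⟨hj, rfl⟩
            · exact fun h => ⟨j₀, h⟩
          simp only [hiff]
          split_ifs <;> simp_all
      rw [expect_bind_sampleGroups]
      simp only [hK, PMF.expect_map, Finset.mem_compl]
      have hmul : ∀ (p : PMF (Finset (Fin (mergeGroups x).length))) (F : _ → ℝ) (c : ℝ),
          p.expect (fun T => F T * c) = p.expect F * c := fun p F c => by
        simp only [PMF.expect, Finset.sum_mul, mul_assoc]
      rw [hmul, PMF.expect_not_mem, ih _ (hx.length_sub_lt h0 h1) hx.complement j₀,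
        groupWeight, if_pos ((hj₀ j₀).mpr rfl), complementProbs, sub_sub_cancel,
        mul_div_cancel₀ _ (hx.groupSum_pos h0 j₀).ne']

/-! ### Concentration -/

/-- Factors are split off one at a time with `A = {i}`; `1 ≤ a i` makes each factor, and the product
of the others, increasing. -/
theorem PMF.NegAssoc.expect_prod_le {α : Type*} [Fintype α] [DecidableEq α] {p : PMF (Finset α)}
    (hp : p.NegAssoc) {a : α → ℝ} (ha : ∀ i, 1 ≤ a i) (S : Finset α) :
    p.expect (fun O => ∏ i ∈ S, if i ∈ O then a i else 1) ≤
      ∏ i ∈ S, p.expect fun O => if i ∈ O then a i else 1 := by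
  have hone : ∀ i (O : Finset α), 1 ≤ if i ∈ O then a i else 1 := fun i O => by
    split_ifs
    exacts [ha i, le_rfl]
  have hmono : ∀ i, Monotone fun O : Finset α => if i ∈ O then a i else 1 := fun i O P h => by
    by_cases hi : i ∈ O
    · simp [hi, h hi]
    · simpa [hi] using hone i P
  induction S using Finset.induction_on with
  | empty => simp [PMF.expect_const]
  | insert i S hi ih =>
    rw [Finset.prod_insert hi]
    have h := hp {i} (fun O => if i ∈ O then a i else 1)
      (fun O => ∏ j ∈ S, if j ∈ O then a j else 1) (hmono i) fun O P h =>
        Finset.prod_le_prod (fun j _ => zero_le_one.trans (hone j O)) fun j _ => hmono j h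
    have h1 : ∀ O : Finset α, (∏ j ∈ S, if j ∈ O \ {i} then a j else 1) =
        ∏ j ∈ S, if j ∈ O then a j else 1 := fun O =>
      Finset.prod_congr rfl fun j hj => by
        have hji : j ≠ i := fun h => hi (h ▸ hj)
        simp [hji]
    simp only [h1, Finset.mem_inter, Finset.mem_singleton, and_true] at h
    simp only [Finset.prod_insert hi]
    refine h.trans (mul_le_mul_of_nonneg_left ih ?_)
    rw [← p.expect_const 0]
    exact p.expect_mono fun O => zero_le_one.trans (hone i O)

/-- Hoeffding's lemma for an indicator: a variable in `[0,1]` has variance proxy `1/4`, whence `s ^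
2 / 8` after centering. -/
theorem PMF.expect_exp_mem_le {α : Type*} [Fintype α] [DecidableEq α] (p : PMF (Finset α)) (i : α)
    (s : ℝ) :
    p.expect (fun O => if i ∈ O then Real.exp s else 1) ≤
      Real.exp (s * (p.expect fun O => if i ∈ O then 1 else 0) + s ^ 2 / 8) := by
  let _ : MeasurableSpace (Finset α) := ⊤
  set x := p.expect fun O => if i ∈ O then 1 else 0 with hx
  have h := (ProbabilityTheory.hasSubgaussianMGF_of_mem_Icc (μ := p.toMeasure) (a := 0) (b := 1)
    (X := fun O : Finset α => if i ∈ O then 1 else 0) .of_discrete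
    (.of_forall fun O => by split_ifs <;> simp)).mgf_le s
  rw [PMF.integral_toMeasure, ← hx, ProbabilityTheory.mgf, PMF.integral_toMeasure] at h
  have h1 : p.expect (fun O => if i ∈ O then Real.exp s else 1) =
      Real.exp (s * x) * p.expect fun O => Real.exp (s * ((if i ∈ O then 1 else 0) - x)) := by
    simp only [PMF.expect, Finset.mul_sum, mul_left_comm (Real.exp _), ← Real.exp_add]
    refine Finset.sum_congr rfl fun O _ => ?_
    split_ifs
    · congr 2; ring
    · rw [← Real.exp_zero]; congr 2; ring
  rw [h1, Real.exp_add]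
  refine mul_le_mul_of_nonneg_left (h.trans (le_of_eq ?_)) (Real.exp_nonneg _)
  simp only [sub_zero, nnnorm_one]
  congr 1
  push_cast
  ring

/-- Hoeffding's inequality for the upper tail of a weighted count of the elements of a negatively
associated random set. -/
theorem PMF.NegAssoc.measure_ge_le {α : Type*} [Fintype α] [DecidableEq α]
    [MeasurableSpace (Finset α)] [DiscreteMeasurableSpace (Finset α)] {p : PMF (Finset α)}
    (hp : p.NegAssoc) {q : α → ℝ} (hq0 : ∀ i, 0 ≤ q i) (hq1 : ∀ i, q i ≤ 1) {ε : ℝ} (hε : 0 ≤ ε)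
    (hα : 0 < Fintype.card α) :
    p.toMeasure.real {O | ε ≤ ∑ i, q i * ((if i ∈ O then 1 else 0) -
        p.expect fun O => if i ∈ O then 1 else 0)} ≤
      Real.exp (-(2 * ε ^ 2 / Fintype.card α)) := by
  set x : α → ℝ := fun i => p.expect fun O => if i ∈ O then 1 else 0 with hx
  set n : ℝ := (Fintype.card α : ℝ) with hn
  have hn0 : 0 < n := Nat.cast_pos.mpr hα
  -- Minimizer of the Chernoff exponent `-t * ε + n * t ^ 2 / 8`, with value `-2 * ε ^ 2 / n`.
  set t : ℝ := 4 * ε / n with ht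
  have ht0 : 0 ≤ t := by positivity
  refine (ProbabilityTheory.measure_ge_le_exp_mul_mgf ε ht0 .of_finite).trans ?_
  have hprod : ∀ O : Finset α, Real.exp (t * ∑ i, q i * ((if i ∈ O then 1 else 0) - x i)) =
      Real.exp (-∑ i, t * q i * x i) * ∏ i, if i ∈ O then Real.exp (t * q i) else 1 := by
    intro O
    rw [← Finset.sum_neg_distrib, Real.exp_sum, ← Finset.prod_mul_distrib, Finset.mul_sum,
      Real.exp_sum]
    refine Finset.prod_congr rfl fun i _ => ?_
    split_ifs
    · rw [← Real.exp_add]; congr 1; ring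
    · rw [mul_one]; congr 1; ring
  have hbound : p.expect (fun O => ∏ i, if i ∈ O then Real.exp (t * q i) else 1) ≤
      Real.exp (∑ i, t * q i * x i + n * (t ^ 2 / 8)) := by
    refine (hp.expect_prod_le (fun i => Real.one_le_exp (mul_nonneg ht0 (hq0 i))) _).trans ?_
    rw [hn, ← nsmul_eq_mul, ← Finset.card_univ, ← Finset.sum_const, ← Finset.sum_add_distrib,
      Real.exp_sum]
    refine Finset.prod_le_prod (fun i _ => ?_) fun i _ => ?_
    · rw [← p.expect_const 0]
      exact p.expect_mono fun O => by split_ifs <;> positivity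
    · refine (p.expect_exp_mem_le i _).trans (Real.exp_le_exp.mpr ?_)
      have : (t * q i) ^ 2 ≤ t ^ 2 := by
        rw [mul_pow]
        exact mul_le_of_le_one_right (sq_nonneg t) (pow_le_one₀ (hq0 i) (hq1 i))
      change t * q i * x i + _ ≤ _
      linarith
  rw [ProbabilityTheory.mgf, PMF.integral_toMeasure]
  change _ * p.expect
    (fun O => Real.exp (t * ∑ i, q i * ((if i ∈ O then 1 else 0) - x i))) ≤ _
  simp only [hprod]
  have hmul : ∀ (c : ℝ) (F : Finset α → ℝ), p.expect (fun O => c * F O) = c * p.expect F :=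
    fun c F => by simp only [PMF.expect, Finset.mul_sum, mul_left_comm]
  rw [hmul]
  calc _ ≤ Real.exp (-t * ε) * (Real.exp (-∑ i, t * q i * x i) *
        Real.exp (∑ i, t * q i * x i + n * (t ^ 2 / 8))) := by gcongr
    _ = _ := by
      rw [← Real.exp_add, ← Real.exp_add, ht]
      congr 1
      field_simp
      ring

/-- Hoeffding's inequality for a weighted count of the elements of a negatively associated random
set. -/
theorem PMF.NegAssoc.measure_abs_ge_le {α : Type*} [Fintype α] [DecidableEq α]
    [MeasurableSpace (Finset α)] [DiscreteMeasurableSpace (Finset α)] {p : PMF (Finset α)}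
    (hp : p.NegAssoc) {q : α → ℝ} (hq0 : ∀ i, 0 ≤ q i) (hq1 : ∀ i, q i ≤ 1) {ε : ℝ} (hε : 0 ≤ ε)
    (hα : 0 < Fintype.card α) :
    p.toMeasure.real {O | ε ≤ |∑ i, q i * ((if i ∈ O then 1 else 0) -
        p.expect fun O => if i ∈ O then 1 else 0)|} ≤
      2 * Real.exp (-(2 * ε ^ 2 / Fintype.card α)) := by
  have h1 := hp.measure_ge_le hq0 hq1 hε hα
  -- The lower tail is the upper tail of the complement, since centering the indicator of `i ∉ O`
  -- only flips the sign.
  have h2 := hp.map_compl.measure_ge_le hq0 hq1 hε hα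
  rw [MeasureTheory.measureReal_def, PMF.toMeasure_map_apply _ _ _ .of_discrete .of_discrete,
    ← MeasureTheory.measureReal_def] at h2
  simp only [PMF.expect_map, Finset.mem_compl, PMF.expect_not_mem, Set.preimage_ofPred_eq] at h2
  rw [two_mul]
  refine (MeasureTheory.measureReal_mono (fun O hO => ?_)).trans
    ((MeasureTheory.measureReal_union_le _ _).trans (add_le_add h1 h2))
  rcases le_abs.mp (Set.mem_ofPred_eq ▸ hO) with h | h
  · exact Or.inl h
  · refine Or.inr (h.trans (le_of_eq ?_))
    rw [← Finset.sum_neg_distrib]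
    refine Finset.sum_congr rfl fun i _ => ?_
    by_cases hi : i ∈ O
    · simp [hi]; ring
    · simp [hi]

/-! ### The random bi-adjacency matrix -/

theorem PMF.NegAssoc.negativelyAssociated_indexMatrix {n₁ n₂ : ℕ}
    {p : PMF (Finset (Fin (n₁ * n₂)))} (hp : p.NegAssoc) :
    NegativelyAssociated
      (fun (e : Fin n₁ × Fin n₂) (B : Matrix (Fin n₁) (Fin n₂) ℝ) => B e.1 e.2)
      (p.map indexMatrix).toMeasure := by
  let _ : MeasurableSpace (Finset (Fin (n₁ * n₂))) := ⊤
  intro A₁ A₂ hA f₁ f₂ hmono h1 h2 h12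
  have hmeas : Measurable (indexMatrix : Finset (Fin (n₁ * n₂)) → _) := .of_discrete
  rw [← PMF.toMeasure_map _ p hmeas] at h1 h2 h12 ⊢
  have : MeasureTheory.IsProbabilityMeasure (p.toMeasure.map indexMatrix) :=
    MeasureTheory.Measure.isProbabilityMeasure_map hmeas.aemeasurable
  -- `f₁` sees only `O ∩ A`, and `f₂` only `O \ A` because `A₂` avoids `A₁`.
  set A := A₁.map finProdFinEquiv.toEmbedding with hAdef
  set F : Finset (Fin (n₁ * n₂)) → ℝ := fun O =>
    f₁ fun i => if finProdFinEquiv i.1 ∈ O then 1 else 0 with hF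
  set G : Finset (Fin (n₁ * n₂)) → ℝ := fun O =>
    f₂ fun i => if finProdFinEquiv i.1 ∈ O then 1 else 0 with hG
  have hF' : ∀ O, F (O ∩ A) = f₁ fun i => indexMatrix O i.1.1 i.1.2 := fun O => by
    simp only [hF]
    congr 1
    funext i
    simp [hAdef, indexMatrix]
  have hG' : ∀ O, G (O \ A) = f₂ fun i => indexMatrix O i.1.1 i.1.2 := fun O => by
    simp only [hG]
    congr 1
    funext i
    have hi : i.1 ∉ A₁ := fun h => Finset.disjoint_left.mp hA h i.2
    simp [hAdef, indexMatrix, hi]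
  have hind : ∀ {ι : Type} (v : ι → Fin (n₁ * n₂)),
      Monotone fun (O : Finset (Fin (n₁ * n₂))) i => if v i ∈ O then (1 : ℝ) else 0 := by
    intro ι v O P h i
    by_cases hi : v i ∈ O
    · simp [hi, h hi]
    · by_cases hi' : v i ∈ P <;> simp [hi, hi']
  have key : p.expect (fun O => F (O ∩ A) * G (O \ A)) ≤
      p.expect (fun O => F (O ∩ A)) * p.expect fun O => G (O \ A) := by
    rcases hmono with ⟨hm1, hm2⟩ | ⟨hm1, hm2⟩
    · exact hp A F G (hm1.comp (hind _)) (hm2.comp (hind _))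
    · exact hp.antitone A (hm1.comp_monotone (hind _)) (hm2.comp_monotone (hind _))
  have hcov : ∀ (X Y : Matrix (Fin n₁) (Fin n₂) ℝ → ℝ),
      MeasureTheory.Integrable X (p.toMeasure.map indexMatrix) →
      MeasureTheory.Integrable Y (p.toMeasure.map indexMatrix) →
      MeasureTheory.Integrable (fun B => X B * Y B) (p.toMeasure.map indexMatrix) →
      ProbabilityTheory.covariance X Y (p.toMeasure.map indexMatrix) =
        p.expect (fun O => X (indexMatrix O) * Y (indexMatrix O)) -
          p.expect (fun O => X (indexMatrix O)) * p.expect fun O => Y (indexMatrix O) := by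
    intro X Y hX hY hXY
    -- Monotone functions of several variables need not be Borel; the measurability for the change
    -- of variables comes from integrability.
    have hmap : ∀ Z : Matrix (Fin n₁) (Fin n₂) ℝ → ℝ,
        MeasureTheory.Integrable Z (p.toMeasure.map indexMatrix) →
        ∫ B, Z B ∂(p.toMeasure.map indexMatrix) = p.expect fun O => Z (indexMatrix O) :=
      fun Z hZ => by
        rw [MeasureTheory.integral_map hmeas.aemeasurable hZ.aestronglyMeasurable,
          PMF.integral_toMeasure]
    rw [ProbabilityTheory.covariance, ← hmap _ hXY, ← hmap _ hX, ← hmap _ hY]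
    set a := ∫ B, X B ∂(p.toMeasure.map indexMatrix)
    set b := ∫ B, Y B ∂(p.toMeasure.map indexMatrix)
    have hexp : ∀ B, (X B - a) * (Y B - b) = X B * Y B - b * X B - (a * Y B - a * b) :=
      fun B => by ring
    have i1 : MeasureTheory.Integrable (fun B => X B * Y B - b * X B)
        (p.toMeasure.map indexMatrix) := hXY.sub (hX.const_mul b)
    have i2 : MeasureTheory.Integrable (fun B => a * Y B - a * b)
        (p.toMeasure.map indexMatrix) := (hY.const_mul a).sub (MeasureTheory.integrable_const _)
    simp only [hexp]
    rw [MeasureTheory.integral_sub i1 i2,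
      MeasureTheory.integral_sub hXY (hX.const_mul b),
      MeasureTheory.integral_sub (hY.const_mul a) (MeasureTheory.integrable_const _),
      MeasureTheory.integral_const_mul, MeasureTheory.integral_const_mul]
    simp
    ring
  rw [hcov _ _ h1 h2 h12, sub_nonpos]
  simpa only [hF', hG'] using key

theorem CrossQuery.vector_mem_Icc {n₁ n₂ d₁ d₂ k : ℕ} {X₁ : Fin d₁ → Type*}
    {X₂ : Fin d₂ → Type*} (D₁ : Fin n₁ → ∀ j, X₁ j) (D₂ : Fin n₂ → ∀ j, X₂ j)
    (c : CrossQuery X₁ X₂ k) (i : Fin (n₁ * n₂)) : c.vector D₁ D₂ i ∈ Set.Icc (0 : ℝ) 1 := by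
  classical
  simp only [CrossQuery.vector, vecM, Matrix.vecMulVec_apply, matchVector, Set.indicator_apply,
    Pi.one_apply]
  split_ifs <;> simp

theorem vecM_indexMatrix {n₁ n₂ : ℕ} (O : Finset (Fin (n₁ * n₂))) (i : Fin (n₁ * n₂)) :
    vecM (indexMatrix O) i = if i ∈ O then 1 else 0 := by
  simp only [vecM, indexMatrix, Matrix.of_apply, Prod.mk.eta, Equiv.apply_symm_apply]

/-- The sampling algorithm answers finitely many queries accurately. -/
theorem unbiasedSampling_accurate {n₁ n₂ m : ℕ} (Bt : Matrix (Fin n₁) (Fin n₂) ℝ)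
    (hB : IsWeightedBiadjacency Bt m) (Q : Finset (Fin (n₁ * n₂) → ℝ))
    (hQ : ∀ q ∈ Q, ∀ i, q i ∈ Set.Icc (0 : ℝ) 1) {β : ℝ} (hβ : 0 < β) :
    1 - β ≤ (unbiasedSampling Bt m hB).toMeasure.real
      {B | ∀ q ∈ Q, |1 / (m : ℝ) * (q ⬝ᵥ vecM B) - 1 / (m : ℝ) * (q ⬝ᵥ vecM Bt)| ≤
        1 / (m : ℝ) * Real.sqrt (((n₁ * n₂ : ℕ) : ℝ) / 2 *
          Real.log (2 * (Q.card : ℝ) / β))} := by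
  let _ : MeasurableSpace (Finset (Fin (n₁ * n₂))) := ⊤
  rcases le_or_gt 1 β with hβ1 | hβ1
  · exact (sub_nonpos.mpr hβ1).trans MeasureTheory.measureReal_nonneg
  have hx := hB.isUBSInput
  set p := UBS (vecM Bt) m hx with hp
  set ε := Real.sqrt (((n₁ * n₂ : ℕ) : ℝ) / 2 * Real.log (2 * (Q.card : ℝ) / β)) with hε
  set good : Set (Matrix (Fin n₁) (Fin n₂) ℝ) :=
    {B | ∀ q ∈ Q, |1 / (m : ℝ) * (q ⬝ᵥ vecM B) - 1 / (m : ℝ) * (q ⬝ᵥ vecM Bt)| ≤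
      1 / (m : ℝ) * ε} with hgood
  -- Only this inequality is needed, and it holds without measurability of `good`.
  have hle : p.toMeasure.real (indexMatrix ⁻¹' good) ≤
      (unbiasedSampling Bt m hB).toMeasure.real good := by
    have hmeas : Measurable (indexMatrix : Finset (Fin (n₁ * n₂)) → _) := .of_discrete
    rw [unbiasedSampling, ← PMF.toMeasure_map _ _ hmeas]
    exact ENNReal.toReal_mono (MeasureTheory.measure_ne_top _ _)
      (MeasureTheory.Measure.le_map_apply hmeas.aemeasurable good)
  refine le_trans ?_ hle
  rw [sub_le_comm, ← MeasureTheory.probReal_compl_eq_one_sub .of_discrete]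
  have hdiff : ∀ (q : Fin (n₁ * n₂) → ℝ) (O : Finset (Fin (n₁ * n₂))),
      1 / (m : ℝ) * (q ⬝ᵥ vecM (indexMatrix O)) - 1 / (m : ℝ) * (q ⬝ᵥ vecM Bt) =
        1 / (m : ℝ) * ∑ i, q i * ((if i ∈ O then 1 else 0) -
          p.expect fun O => if i ∈ O then 1 else 0) := fun q O => by
    simp only [hp, UBS_expect_mem, dotProduct, vecM_indexMatrix, mul_sub, Finset.sum_sub_distrib]
  have hsub : (indexMatrix ⁻¹' good)ᶜ ⊆ ⋃ q ∈ Q, {O | ε ≤ |∑ i, q i * ((if i ∈ O then 1 else 0) -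
      p.expect fun O => if i ∈ O then 1 else 0)|} := by
    intro O hO
    simp only [hgood, Set.mem_compl_iff, Set.mem_preimage, Set.mem_ofPred_eq, not_forall, not_le,
      hdiff, abs_mul, abs_of_nonneg (one_div_nonneg.mpr (Nat.cast_nonneg (α := ℝ) m))] at hO
    obtain ⟨q, hq, hlt⟩ := hO
    exact Set.mem_biUnion (x := q) hq
      (lt_of_mul_lt_mul_left hlt (one_div_nonneg.mpr (Nat.cast_nonneg m))).le
  rcases Q.eq_empty_or_nonempty with hQe | hQne
  · have : (indexMatrix ⁻¹' good)ᶜ = ∅ := by simp [hgood, hQe]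
    rw [this, MeasureTheory.measureReal_empty]
    exact hβ.le
  -- Without entries `m = 0`, so `1 / m = 0` by convention and both sides of the bound vanish.
  rcases Nat.eq_zero_or_pos (n₁ * n₂) with hN | hN
  · have hm : (m : ℝ) = 0 := by
      rw [← hx.sum_eq]
      have : IsEmpty (Fin (n₁ * n₂)) := hN ▸ Fin.isEmpty'
      exact Fintype.sum_empty _
    have : (indexMatrix ⁻¹' good)ᶜ = ∅ := by simp [hgood, hm]
    rw [this, MeasureTheory.measureReal_empty]
    exact hβ.le
  have hcard : (1 : ℝ) ≤ Q.card := by exact_mod_cast hQne.card_pos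
  have hNr : (0 : ℝ) < ((n₁ * n₂ : ℕ) : ℝ) := by exact_mod_cast hN
  have hlog : 0 ≤ Real.log (2 * (Q.card : ℝ) / β) :=
    Real.log_nonneg (by rw [le_div_iff₀ hβ]; linarith)
  -- `ε` is chosen so that each query fails with probability at most `β / Q.card`.
  have htail : 2 * Real.exp (-(2 * ε ^ 2 / Fintype.card (Fin (n₁ * n₂)))) = β / Q.card := by
    rw [Fintype.card_fin, hε, Real.sq_sqrt (by positivity)]
    have : 2 * (((n₁ * n₂ : ℕ) : ℝ) / 2 * Real.log (2 * (Q.card : ℝ) / β)) / ((n₁ * n₂ : ℕ) : ℝ) =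
        Real.log (2 * (Q.card : ℝ) / β) := by
      field_simp
    rw [this, Real.exp_neg, Real.exp_log (by positivity)]
    field_simp
  calc _ ≤ _ := MeasureTheory.measureReal_mono hsub (MeasureTheory.measure_ne_top _ _)
    _ ≤ _ := MeasureTheory.measureReal_biUnion_finset_le _ _
    _ ≤ ∑ q ∈ Q, β / Q.card := Finset.sum_le_sum fun q hq => by
        rw [← htail]
        exact (UBS_negAssoc hx).measure_abs_ge_le (fun i => (hQ q hq i).1)
          (fun i => (hQ q hq i).2) (Real.sqrt_nonneg _) (by rwa [Fintype.card_fin])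
    _ = β := by
        rw [Finset.sum_const, nsmul_eq_mul]
        field_simp

theorem theorem5 {n₁ n₂ d₁ d₂ k m : ℕ} {X₁ : Fin d₁ → Type*} {X₂ : Fin d₂ → Type*}
    (D₁ : Fin n₁ → ∀ j, X₁ j) (D₂ : Fin n₂ → ∀ j, X₂ j)
    (Bt : Matrix (Fin n₁) (Fin n₂) ℝ) (hB : IsWeightedBiadjacency Bt m) :
    NegativelyAssociated
        (fun (e : Fin n₁ × Fin n₂) (B : Matrix (Fin n₁) (Fin n₂) ℝ) => B e.1 e.2)
        (unbiasedSampling Bt m hB).toMeasure ∧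
      ∀ (Q : Finset (Fin (n₁ * n₂) → ℝ)),
        (∀ q ∈ Q, ∃ c : CrossQuery X₁ X₂ k, q = c.vector D₁ D₂) →
        ∀ β : ℝ, 0 < β →
          1 - β ≤ (unbiasedSampling Bt m hB).toMeasure.real
            {B | ∀ q ∈ Q, |1 / (m : ℝ) * (q ⬝ᵥ vecM B) - 1 / (m : ℝ) * (q ⬝ᵥ vecM Bt)| ≤
              1 / (m : ℝ) * Real.sqrt (((n₁ * n₂ : ℕ) : ℝ) / 2 *
                Real.log (2 * (Q.card : ℝ) / β))} := by
  refine ⟨(UBS_negAssoc hB.isUBSInput).negativelyAssociated_indexMatrix, fun Q hQ β hβ =>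
    unbiasedSampling_accurate Bt hB Q (fun q hq i => ?_) hβ⟩
  obtain ⟨c, rfl⟩ := hQ q hq
  exact c.vector_mem_Icc D₁ D₂ i
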